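/- Let $q$ be a formal variable. For a non-negative integer $n$ put $(a;q)_n=\prod_{i=0}^{n-1}(1-aq^i)$, with the convention $1/(q;q)_n=0$ for integers $n<0$ (and likewise for $q^3$ in place of $q$). For integers $N,k$ let ${N\brack k}_q=\frac{(q;q)_N}{(q;q)_k(q;q)_{N-k}}$ if $k\ge 0$ and $N-k\ge 0$, and ${N\brack k}_q=0$ otherwise. Put $Q(m,n)=2m^2+6mn+6n^2$. Theorem. For every integer $M\ge 0$, the following identity holds in $\mathbb{Q}(q)$: $$\sum_{m,n\ge 0}\frac{q^{Q(m,n)+m+3n}(q^3;q^3)_M}{(q;q)_m(q^3;q^3)_n(q^3;q^3)_{M-2n-m}}+\sum_{m,n\ge 0}\frac{q^{Q(m,n)+3m+6n+1}(q^3;q^3)_M}{(q;q)_m(q^3;q^3)_n(q^3;q^3)_{M-2n-m}}=\sum_{j=-M-1}^{M}q^{3j^2+2j}{2M+1\brack M-j}_{q^3}.$$ Moreover, it is a polynomial identity: both sides are polynomials in $q$ with integer coefficients. -/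

import Mathlib

/-- The `q`-Pochhammer symbol `(a; q)_n = (1 - a)(1 - a q) ⋯ (1 - a q^(n-1))`
for a natural number `n`. -/
def qPochhammer {K : Type*} [Field K] (a q : K) (n : ℕ) : K :=
  ∏ i ∈ Finset.range n, (1 - a * q ^ i)

/-- The reciprocal `1 / (q; q)_n` for an integer `n`, with the usual convention
`1 / (q; q)_n = 0` for `n < 0`. -/
def qPochhammerRecip {K : Type*} [Field K] (q : K) (n : ℤ) : K :=
  if n < 0 then 0 else 1 / qPochhammer q q n.toNat

/-- The `q`-binomial coefficient `[N, k]_q = (q; q)_N / ((q; q)_k (q; q)_(N-k))` if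
`k ≥ 0` and `N - k ≥ 0`, and `0` otherwise. -/
def qBinomial {K : Type*} [Field K] (q : K) (N k : ℤ) : K :=
  if 0 ≤ k ∧ 0 ≤ N - k then
    qPochhammer q q N.toNat / (qPochhammer q q k.toNat * qPochhammer q q (N - k).toNat)
  else 0

/-- The quadratic form `Q(m, n) = 2 m² + 6 m n + 6 n²`. -/
def capparelliQ (m n : ℕ) : ℕ := 2 * m ^ 2 + 6 * m * n + 6 * n ^ 2

/-- The factor `(q³; q³)_M / ((q; q)_m (q³; q³)_n (q³; q³)_(M-2n-m))`; it vanishes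
when `M - 2n - m < 0`. -/
def capparelliFactor {K : Type*} [Field K] (q : K) (M m n : ℕ) : K :=
  qPochhammer (q ^ 3) (q ^ 3) M * qPochhammerRecip q m * qPochhammerRecip (q ^ 3) n *
    qPochhammerRecip (q ^ 3) ((M : ℤ) - 2 * n - m)

/-- Only finitely many pairs `(m, n)` contribute to a double sum with the factor above,
so that such a sum over all `m, n ≥ 0` is a genuine (finite) sum. -/
theorem capparelliFactor_support_finite {K : Type*} [Field K] (q : K) (M : ℕ)
    (e : ℕ → ℕ → ℕ) :
    (Function.support fun p : ℕ × ℕ =>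
      q ^ e p.1 p.2 * capparelliFactor q M p.1 p.2).Finite := by
  refine ((Finset.range (M + 1)) ×ˢ (Finset.range (M + 1))).finite_toSet.subset ?_
  rintro ⟨m, n⟩ h
  by_contra hmn
  apply h
  have hneg : (M : ℤ) - 2 * n - m < 0 := by
    simp only [Finset.coe_product, Finset.coe_range, Set.mem_prod, Set.mem_Iio] at hmn
    omega
  simp [capparelliFactor, qPochhammerRecip, hneg]

/-! Write p = q³ and let S_N(a,b) be the double sum with exponent Q(m,n) + am + bn and last index
N-2n-m (`capparelliSum`). The q-Pascal rule splits the right side into two theta sums ∑ p^(a²) z^a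
[2M, M-a]_p, with z = q² and z = q. For general z such a sum is expanded by q-Vandermonde, a
linearization of [M,X][M,Y] and the Durfee rectangle identity. After a change of variables, two
indices (m,k) carry the quadratic form, and the other two sum to the coefficient of s^m in
(-s/z;p)_∞ (-s;p)_∞ (-sz;p)_∞ (`finsum_theta_qBinomial`). For z = q and z = q² the three products
run through the residues mod 3 and merge into a single (-s;q)_∞, up to rescaling s or one extra
linear factor. Euler's expansion then supplies the 1/(q;q)_m, so both theta sums are combinations of
S_N(a,b). Contiguous relations (`capparelliSum_relation`) turn these into S_M(1,3) + q S_M(3,6).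
Integrality follows from q-Pascal and 3j² + 2j ≥ 0. -/

/-! ### q-binomial convolutions over integer indices -/

section Recip

variable {K : Type*} [Field K] {p : K}

theorem qPochhammer_succ (p : K) (n : ℕ) :
    qPochhammer p p (n + 1) = qPochhammer p p n * (1 - p ^ (n + 1)) := by
  rw [qPochhammer, Finset.prod_range_succ, qPochhammer, pow_succ' p n]

theorem qPochhammer_ne_zero (hp : ∀ n : ℕ, 0 < n → p ^ n ≠ 1) (n : ℕ) :
    qPochhammer p p n ≠ 0 := by
  rw [qPochhammer, Finset.prod_ne_zero_iff]
  intro i _ h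
  apply hp (i + 1) (Nat.succ_pos i)
  rw [pow_succ']
  exact (sub_eq_zero.mp h).symm

theorem qPochhammerRecip_of_neg (p : K) {n : ℤ} (h : n < 0) : qPochhammerRecip p n = 0 :=
  if_pos h

theorem qPochhammerRecip_natCast (p : K) (n : ℕ) :
    qPochhammerRecip p n = (qPochhammer p p n)⁻¹ := by
  simp [qPochhammerRecip]

theorem qPochhammerRecip_zero (p : K) : qPochhammerRecip p 0 = 1 := by
  simp [qPochhammerRecip, qPochhammer]

theorem nonneg_of_qPochhammerRecip_ne_zero {n : ℤ} (h : qPochhammerRecip p n ≠ 0) : 0 ≤ n := by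
  by_contra hn
  exact h (qPochhammerRecip_of_neg p (by omega))

/-- At n = 0 the factor 1 - p^0 vanishes, in agreement with the convention for negative indices.
Hence the recurrences derived from it have no boundary cases. -/
theorem qPochhammerRecip_sub_one (hp : ∀ n : ℕ, 0 < n → p ^ n ≠ 1) (n : ℤ) :
    qPochhammerRecip p (n - 1) = (1 - p ^ n) * qPochhammerRecip p n := by
  rcases lt_trichotomy n 0 with h | rfl | h
  · rw [qPochhammerRecip_of_neg p h, qPochhammerRecip_of_neg p (by omega), mul_zero]
  · rw [qPochhammerRecip_of_neg p (by omega)]; simp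
  · obtain ⟨m, rfl⟩ : ∃ m : ℕ, n = (m : ℤ) + 1 := ⟨(n - 1).toNat, by omega⟩
    have h1 := qPochhammer_ne_zero hp m
    have h2 : (1 : K) - p ^ (m + 1) ≠ 0 := fun h =>
      hp (m + 1) (Nat.succ_pos m) (sub_eq_zero.mp h).symm
    have h3 : qPochhammerRecip p ((m : ℤ) + 1) = (qPochhammer p p (m + 1))⁻¹ := by
      exact_mod_cast qPochhammerRecip_natCast p (m + 1)
    rw [add_sub_cancel_right, qPochhammerRecip_natCast, h3, qPochhammer_succ]
    have h4 : p ^ ((m : ℤ) + 1) = p ^ (m + 1) := by exact_mod_cast zpow_natCast p (m + 1)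
    rw [h4]
    field_simp

theorem qBinomial_natCast (p : K) (N : ℕ) (k : ℤ) :
    qBinomial p N k =
      qPochhammer p p N * qPochhammerRecip p k * qPochhammerRecip p (N - k) := by
  unfold qBinomial qPochhammerRecip
  by_cases h1 : 0 ≤ k <;> by_cases h2 : 0 ≤ (N : ℤ) - k
  · rw [if_pos ⟨h1, h2⟩, if_neg (by omega), if_neg (by omega)]
    simp only [Int.toNat_natCast]
    field_simp
  · rw [if_neg (by tauto), if_pos (show (N : ℤ) - k < 0 by omega)]; simp
  · rw [if_neg (by tauto), if_pos (show k < 0 by omega)]; simp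
  · rw [if_neg (by tauto), if_pos (show k < 0 by omega)]; simp

theorem qBinomial_symm (p : K) (N : ℕ) (k : ℤ) : qBinomial p N (N - k) = qBinomial p N k := by
  rw [qBinomial_natCast, qBinomial_natCast, sub_sub_cancel]; ring

theorem bounds_of_qBinomial_ne_zero {N : ℕ} {k : ℤ} (h : qBinomial p N k ≠ 0) :
    0 ≤ k ∧ 0 ≤ (N : ℤ) - k := by
  by_contra hn
  exact h (if_neg hn)

theorem qBinomial_zero_left (p : K) (k : ℤ) : qBinomial p (0 : ℕ) k = if k = 0 then 1 else 0 := by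
  split_ifs with h
  · subst h; simp [qBinomial, qPochhammer]
  · exact if_neg (by push_cast; omega)

theorem qBinomial_succ (hp0 : p ≠ 0) (hp : ∀ n : ℕ, 0 < n → p ^ n ≠ 1) (N : ℕ) (k : ℤ) :
    qBinomial p (N + 1 : ℕ) k =
      qBinomial p N k + p ^ ((N : ℤ) + 1 - k) * qBinomial p N (k - 1) := by
  simp only [qBinomial_natCast]
  have h1 := qPochhammerRecip_sub_one hp k
  have h2 := qPochhammerRecip_sub_one hp ((N : ℤ) + 1 - k)
  rw [show (N : ℤ) + 1 - k - 1 = N - k by ring] at h2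
  rw [h1, h2, qPochhammer_succ, show (N : ℤ) - (k - 1) = N + 1 - k by ring]
  have h3 : p ^ (N + 1) = p ^ ((N : ℤ) + 1 - k) * p ^ k := by
    rw [← zpow_add₀ hp0, ← zpow_natCast]; congr 1; push_cast; ring
  rw [h3]
  push_cast
  ring

theorem finite_support_int {f : ℤ → K} (lo hi : ℤ) (h : ∀ k, f k ≠ 0 → lo ≤ k ∧ k ≤ hi) :
    (Function.support f).Finite :=
  (Set.finite_Icc lo hi).subset fun k hk => h k hk

theorem finsum_int_shift (f : ℤ → K) (a : ℤ) : ∑ᶠ k, f (k + a) = ∑ᶠ k, f k :=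
  finsum_comp_equiv (Equiv.addRight a)

theorem finsum_eq_add_of_shift {f g h : ℤ → K} (a : ℤ) (key : ∀ k, f k = g k + h (k + a))
    (hg : (Function.support g).Finite) (hh : (Function.support h).Finite) :
    ∑ᶠ k, f k = ∑ᶠ k, g k + ∑ᶠ k, h k := by
  rw [finsum_congr key, finsum_add_distrib hg, finsum_int_shift]
  exact hh.preimage (add_left_injective a).injOn

/-- The `q`-Vandermonde convolution. -/
theorem finsum_qBinomial_mul_qBinomial (hp0 : p ≠ 0) (hp : ∀ n : ℕ, 0 < n → p ^ n ≠ 1)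
    (A B : ℕ) (s : ℤ) :
    ∑ᶠ k : ℤ, p ^ (k * (B - s + k)) * (qBinomial p A k * qBinomial p B (s - k)) =
      qBinomial p (A + B : ℕ) s := by
  induction A generalizing s with
  | zero =>
    rw [finsum_eq_single _ 0]
    · rw [qBinomial_zero_left]; simp
    · intro k hk
      rw [qBinomial_zero_left, if_neg hk]; simp
  | succ A ih =>
    have fin : ∀ (g : ℤ → K) (t : ℤ), (Function.support fun k : ℤ =>
        g k * (qBinomial p A k * qBinomial p B (t - k))).Finite := by
      intro g t
      apply finite_support_int 0 A
      intro k hk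
      have := bounds_of_qBinomial_ne_zero (left_ne_zero_of_mul (right_ne_zero_of_mul hk))
      omega
    -- Pascal is applied to both sides; the second Pascal term on the left matches the sum for s - 1
    -- after k ↦ k - 1.
    rw [show A + 1 + B = (A + B) + 1 by ring, qBinomial_succ hp0 hp, ← ih, ← ih, mul_finsum]
    refine finsum_eq_add_of_shift (-1) ?_ (fin _ s) ?_
    · intro k
      rw [qBinomial_succ hp0 hp]
      have : p ^ (((A + B : ℕ) : ℤ) + 1 - s) * p ^ ((k + -1) * (B - (s - 1) + (k + -1))) =
          p ^ (k * (B - s + k)) * p ^ ((A : ℤ) + 1 - k) := by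
        rw [← zpow_add₀ hp0, ← zpow_add₀ hp0]; congr 1; push_cast; ring
      rw [← mul_assoc (p ^ (((A + B : ℕ) : ℤ) + 1 - s)), this,
        show s - 1 - (k + -1) = s - k by ring, show k + -1 = k - 1 by ring]
      ring
    · simp only [← mul_assoc (p ^ (((A + B : ℕ) : ℤ) + 1 - s))]
      exact fin _ _

/-- The Durfee rectangle expansion of `1 / (p; p)_x`. -/
theorem finsum_qBinomial_mul_qPochhammerRecip (hp0 : p ≠ 0) (hp : ∀ n : ℕ, 0 < n → p ^ n ≠ 1)
    (x : ℤ) (y : ℕ) :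
    ∑ᶠ k : ℤ, p ^ ((x - k) * (y - k)) * (qBinomial p y k * qPochhammerRecip p (x - k)) =
      qPochhammerRecip p x := by
  induction y with
  | zero =>
    rw [finsum_eq_single _ 0]
    · rw [qBinomial_zero_left]; simp
    · intro k hk
      rw [qBinomial_zero_left, if_neg hk]; simp
  | succ y ih =>
    have fin : ∀ g : ℤ → K, (Function.support fun k : ℤ => g k * (p ^ ((x - k) * (y - k)) *
        (qBinomial p y k * qPochhammerRecip p (x - k)))).Finite := by
      intro g
      apply finite_support_int 0 y
      intro k hk
      have := bounds_of_qBinomial_ne_zero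
        (left_ne_zero_of_mul (right_ne_zero_of_mul (right_ne_zero_of_mul hk)))
      omega
    -- The two Pascal terms, the second one shifted, are the summand for y with weights p^(x-k) and
    -- 1 - p^(x-k), which add up to 1.
    rw [finsum_eq_add_of_shift (-1) _ (fin fun k => p ^ (x - k)) (fin fun k => 1 - p ^ (x - k)),
      ← finsum_add_distrib (fin _) (fin _), ← ih]
    · apply finsum_congr; intro k; ring
    · intro k
      rw [qBinomial_succ hp0 hp]
      have h1 := qPochhammerRecip_sub_one hp (x - (k + -1))
      rw [show x - (k + -1) - 1 = x - k by ring] at h1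
      have e1 : p ^ ((x - k) * ((y + 1 : ℕ) - k)) = p ^ (x - k) * p ^ ((x - k) * (y - k)) := by
        rw [← zpow_add₀ hp0]; congr 1; push_cast; ring
      have e2 : p ^ ((x - (k + -1)) * (y - (k + -1))) =
          p ^ (x - k) * p ^ ((x - k) * (y - k)) * p ^ ((y : ℤ) + 1 - k) := by
        rw [← zpow_add₀ hp0, ← zpow_add₀ hp0]; congr 1; ring
      rw [e1, e2, add_mul, mul_add]
      congr 1
      · ring
      · rw [h1, show k + -1 = k - 1 by ring]; ring

/-- Symmetric form of the Durfee rectangle expansion. -/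
theorem qPochhammerRecip_mul_qPochhammerRecip (hp0 : p ≠ 0) (hp : ∀ n : ℕ, 0 < n → p ^ n ≠ 1)
    (x y : ℤ) :
    qPochhammerRecip p x * qPochhammerRecip p y =
      ∑ᶠ k : ℤ, p ^ ((x - k) * (y - k)) * (qPochhammerRecip p k * qPochhammerRecip p (x - k) *
        qPochhammerRecip p (y - k)) := by
  by_cases hy : y < 0
  · rw [qPochhammerRecip_of_neg p hy, mul_zero, eq_comm]
    apply finsum_eq_zero_of_forall_eq_zero
    intro k
    by_cases hk : k < 0
    · rw [qPochhammerRecip_of_neg p hk]; simp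
    · rw [qPochhammerRecip_of_neg p (show y - k < 0 by omega)]; simp
  · obtain ⟨n, rfl⟩ : ∃ n : ℕ, y = n := ⟨y.toNat, by omega⟩
    rw [← finsum_qBinomial_mul_qPochhammerRecip hp0 hp x n, finsum_mul]
    apply finsum_congr
    intro k
    rw [qBinomial_natCast, qPochhammerRecip_natCast p n]
    have := qPochhammer_ne_zero hp n
    field_simp

/-- Linearization of a product of two `q`-binomial coefficients. -/
theorem qBinomial_mul_qBinomial (hp0 : p ≠ 0) (hp : ∀ n : ℕ, 0 < n → p ^ n ≠ 1)
    (M : ℕ) (X Y : ℤ) :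
    qBinomial p M X * qBinomial p M Y =
      ∑ᶠ x : ℤ, qPochhammer p p M * (p ^ (x * (Y - X + x)) * (qPochhammerRecip p x *
        qPochhammerRecip p (M - Y - x) * qPochhammerRecip p (X - x) *
        qPochhammerRecip p (Y - X + x))) := by
  by_cases hY : 0 ≤ Y ∧ 0 ≤ (M : ℤ) - Y
  · obtain ⟨n, rfl⟩ : ∃ n : ℕ, Y = n := ⟨Y.toNat, by omega⟩
    obtain ⟨m, rfl⟩ : ∃ m : ℕ, M = m + n := ⟨M - n, by omega⟩
    -- Vandermonde with M = (M-Y) + Y expands [M,X]; the factorials of Y and M-Y then cancel against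
    -- [M,Y].
    rw [← finsum_qBinomial_mul_qBinomial hp0 hp m n X, finsum_mul]
    apply finsum_congr
    intro x
    simp only [qBinomial_natCast]
    rw [show (m + n : ℕ) - (n : ℤ) = m by push_cast; ring,
      show (n : ℤ) - (X - x) = n - X + x by ring, qPochhammerRecip_natCast, qPochhammerRecip_natCast]
    have := qPochhammer_ne_zero hp n
    have := qPochhammer_ne_zero hp m
    field_simp
  · rw [show qBinomial p M Y = 0 from if_neg hY, mul_zero, eq_comm]
    apply finsum_eq_zero_of_forall_eq_zero
    intro x
    by_contra h
    simp only [mul_eq_zero, not_or] at h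
    obtain ⟨_, _, ⟨⟨h1, h2⟩, h3⟩, h4⟩ := h
    have := nonneg_of_qPochhammerRecip_ne_zero h1
    have := nonneg_of_qPochhammerRecip_ne_zero h2
    have := nonneg_of_qPochhammerRecip_ne_zero h3
    have := nonneg_of_qPochhammerRecip_ne_zero h4
    omega

end Recip

/-! ### Expansion of theta sums of q-binomials -/

section Expansion

variable {K : Type*} [Field K] {p : K}

/-- The coefficient `p ^ (n choose 2) / (p; p)_n` in Euler's expansion of `(-s; p)_∞`. -/
noncomputable def eulerCoeff (p : K) (n : ℤ) : K :=
  p ^ (n * (n - 1) / 2) * qPochhammerRecip p n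

/-- The coefficient of `s ^ m` in `(-s / z; p)_∞ (-s; p)_∞ (-s z; p)_∞`. -/
noncomputable def tripleCoeff (p z : K) (m : ℤ) : K :=
  ∑ᶠ x : ℤ, ∑ᶠ y : ℤ,
    z ^ (y - x) * (eulerCoeff p x * eulerCoeff p y * eulerCoeff p (m - x - y))

theorem two_mul_int_choose_two (n : ℤ) : 2 * (n * (n - 1) / 2) = n * (n - 1) :=
  Int.mul_ediv_cancel' (Int.even_mul_pred_self n).two_dvd

theorem finsum_curry_four {f : ℤ × ℤ × ℤ × ℤ → K} (hf : (Function.support f).Finite) :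
    ∑ᶠ t, f t = ∑ᶠ a, ∑ᶠ b, ∑ᶠ c, ∑ᶠ d, f (a, b, c, d) := by
  rw [finsum_curry f hf]
  apply finsum_congr; intro a
  have h1 : (Function.support fun t => f (a, t)).Finite :=
    hf.preimage (Prod.mk_right_injective a).injOn
  rw [finsum_curry _ h1]
  apply finsum_congr; intro b
  exact finsum_curry _ (h1.preimage (Prod.mk_right_injective b).injOn)

/-- The change of variables `(a, X, x, k) ↦ (m, k, x - k, a + x - k)` with
`m = X + a + x - 2 k`. -/
def expansionEquiv : ℤ × ℤ × ℤ × ℤ ≃ ℤ × ℤ × ℤ × ℤ where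
  toFun t := (t.2.1 + t.1 + t.2.2.1 - 2 * t.2.2.2, t.2.2.2, t.2.2.1 - t.2.2.2,
    t.1 + t.2.2.1 - t.2.2.2)
  invFun t := (t.2.2.2 - t.2.2.1, t.1 - t.2.2.2 + t.2.1, t.2.2.1 + t.2.1, t.2.1)
  left_inv := by rintro ⟨a, X, x, k⟩; ext <;> simp; ring
  right_inv := by rintro ⟨m, k, x, y⟩; ext <;> simp <;> ring

/-- The quadruple summand that appears after expanding the `q`-binomial coefficients. -/
noncomputable def expansionTerm (p z : K) (M : ℕ) (t : ℤ × ℤ × ℤ × ℤ) : K :=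
  qPochhammerRecip p (M - 2 * t.2.1 - t.1) * qPochhammerRecip p t.2.1 *
    p ^ (2 * t.2.1 ^ 2 + 2 * t.2.1 * t.1 + (t.1 + 1) * t.1 / 2) *
    (z ^ (t.2.2.2 - t.2.2.1) * (eulerCoeff p t.2.2.1 * eulerCoeff p t.2.2.2 *
      eulerCoeff p (t.1 - t.2.2.1 - t.2.2.2)))

theorem expansionTerm_support_finite (p z : K) (M : ℕ) :
    (Function.support (expansionTerm p z M)).Finite := by
  refine (Set.finite_Icc ((-M, -M, -M, -M) : ℤ × ℤ × ℤ × ℤ) (M, M, M, M)).subset ?_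
  rintro ⟨m, k, x, y⟩ h
  simp only [Function.mem_support, expansionTerm, eulerCoeff, ne_eq, mul_eq_zero, not_or] at h
  obtain ⟨⟨⟨h1, h2⟩, -⟩, -, ⟨⟨-, h3⟩, -, h4⟩, -, h5⟩ := h
  have := nonneg_of_qPochhammerRecip_ne_zero h1
  have := nonneg_of_qPochhammerRecip_ne_zero h2
  have := nonneg_of_qPochhammerRecip_ne_zero h3
  have := nonneg_of_qPochhammerRecip_ne_zero h4
  have := nonneg_of_qPochhammerRecip_ne_zero h5
  simp only [Set.mem_Icc, Prod.mk_le_mk]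
  omega

/-- The three Euler indices x-k, a+x-k and X-x add up to m. Once their binomials n(n-1)/2 are split
off, the remaining exponent depends on m and k only, so the inner sum decouples. -/
theorem expansionTerm_expansionEquiv (hp0 : p ≠ 0) (z : K) (M : ℕ) (a X x k : ℤ) :
    expansionTerm p z M (expansionEquiv (a, X, x, k)) =
      p ^ (a ^ 2) * z ^ a * p ^ (X * (X + a)) * p ^ (x * (X + a - X + x)) *
        (qPochhammerRecip p (M - (X + a) - x) * qPochhammerRecip p (X - x)) *
        (p ^ ((x - k) * (X + a - X + x - k)) * (qPochhammerRecip p k *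
          qPochhammerRecip p (x - k) * qPochhammerRecip p (X + a - X + x - k))) := by
  simp only [expansionTerm, expansionEquiv, Equiv.coe_fn_mk, eulerCoeff]
  rw [show (M : ℤ) - 2 * k - (X + a + x - 2 * k) = M - (X + a) - x by ring,
    show X + a + x - 2 * k - (x - k) - (a + x - k) = X - x by ring,
    show X + a - X + x - k = a + x - k by ring, show a + x - k - (x - k) = a by ring]
  have e : p ^ (a ^ 2) * p ^ (X * (X + a)) * p ^ (x * (X + a - X + x)) *
      p ^ ((x - k) * (a + x - k)) =
      p ^ (2 * k ^ 2 + 2 * k * (X + a + x - 2 * k) +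
        (X + a + x - 2 * k + 1) * (X + a + x - 2 * k) / 2) *
      p ^ ((x - k) * (x - k - 1) / 2) * p ^ ((a + x - k) * (a + x - k - 1) / 2) *
      p ^ ((X - x) * (X - x - 1) / 2) := by
    simp only [← zpow_add₀ hp0]
    congr 1
    have h1 := two_mul_int_choose_two (X + a + x - 2 * k + 1)
    rw [add_sub_cancel_right] at h1
    have h2 := two_mul_int_choose_two (x - k)
    have h3 := two_mul_int_choose_two (a + x - k)
    have h4 := two_mul_int_choose_two (X - x)
    -- Doubling clears the integer divisions by 2.
    refine mul_left_cancel₀ (two_ne_zero : (2 : ℤ) ≠ 0) ?_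
    linear_combination -h1 - h2 - h3 - h4
  linear_combination (-(z ^ a * qPochhammerRecip p (M - (X + a) - x) * qPochhammerRecip p (X - x) *
    qPochhammerRecip p k * qPochhammerRecip p (x - k) * qPochhammerRecip p (a + x - k))) * e

/-- Both sides are iterated forms of one finite quadruple sum, in the coordinates (a,X,x,k) and
(m,k,x,y) respectively. -/
theorem finsum_theta_qBinomial (hp0 : p ≠ 0) (hp : ∀ n : ℕ, 0 < n → p ^ n ≠ 1) (z : K) (M : ℕ) :
    ∑ᶠ a : ℤ, p ^ (a ^ 2) * z ^ a * qBinomial p (2 * M : ℕ) (M - a) =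
      qPochhammer p p M * ∑ᶠ t : ℤ × ℤ,
        qPochhammerRecip p (M - 2 * t.2 - t.1) * qPochhammerRecip p t.2 *
          p ^ (2 * t.2 ^ 2 + 2 * t.2 * t.1 + (t.1 + 1) * t.1 / 2) * tripleCoeff p z t.1 := by
  have hfin := expansionTerm_support_finite p z M
  have hR : ∑ᶠ t, expansionTerm p z M t = ∑ᶠ t : ℤ × ℤ,
      qPochhammerRecip p (M - 2 * t.2 - t.1) * qPochhammerRecip p t.2 *
          p ^ (2 * t.2 ^ 2 + 2 * t.2 * t.1 + (t.1 + 1) * t.1 / 2) * tripleCoeff p z t.1 := by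
    have hc : (Function.support fun t : ℤ × ℤ =>
        qPochhammerRecip p (M - 2 * t.2 - t.1) * qPochhammerRecip p t.2 *
          p ^ (2 * t.2 ^ 2 + 2 * t.2 * t.1 + (t.1 + 1) * t.1 / 2) *
            tripleCoeff p z t.1).Finite := by
      refine (hfin.image fun t => (t.1, t.2.1)).subset ?_
      rintro ⟨m, k⟩ h
      by_contra hn
      apply h
      simp only [tripleCoeff]
      rw [mul_finsum]
      apply finsum_eq_zero_of_forall_eq_zero
      intro x
      rw [mul_finsum]
      apply finsum_eq_zero_of_forall_eq_zero
      intro y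
      by_contra hxy
      exact hn ⟨(m, k, x, y), hxy, rfl⟩
    rw [finsum_curry_four hfin, finsum_curry _ hc]
    apply finsum_congr; intro m
    apply finsum_congr; intro k
    simp only [tripleCoeff]
    rw [mul_finsum]
    apply finsum_congr; intro x
    rw [mul_finsum]
    rfl
  have hfin' : (Function.support fun t => expansionTerm p z M (expansionEquiv t)).Finite :=
    hfin.preimage expansionEquiv.injective.injOn
  rw [← hR, ← finsum_comp_equiv expansionEquiv, finsum_curry_four hfin', mul_finsum]
  apply finsum_congr; intro a
  -- Vandermonde and symmetry give ∑ p^(X(X+a)) [M,X][M,X+a]; linearization adds the index x, and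
  -- the Durfee expansion of 1/((p;p)_x (p;p)_(a+x)) adds k.
  rw [two_mul, ← finsum_qBinomial_mul_qBinomial hp0 hp M M, mul_finsum, mul_finsum]
  apply finsum_congr; intro X
  rw [show (M : ℤ) - a - X = M - (X + a) by ring, qBinomial_symm, qBinomial_mul_qBinomial hp0 hp,
    mul_finsum, mul_finsum, mul_finsum]
  apply finsum_congr; intro x
  simp only [expansionTerm_expansionEquiv hp0]
  rw [← mul_finsum, ← qPochhammerRecip_mul_qPochhammerRecip hp0 hp,
    show (M : ℤ) - (M - a) + X = X + a by ring]
  ring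

end Expansion

/-! ### Euler's series and products modulo three -/

section TripleProduct

open PowerSeries

variable {K : Type*} [Field K] {p q : K}

/-- The coefficient of a power series at an integer index, zero at negative indices. -/
noncomputable def intCoeff (F : PowerSeries K) (n : ℤ) : K :=
  if n < 0 then 0 else coeff n.toNat F

theorem intCoeff_natCast (F : PowerSeries K) (n : ℕ) : intCoeff F n = coeff n F := by
  simp [intCoeff]

theorem intCoeff_of_neg (F : PowerSeries K) {n : ℤ} (h : n < 0) : intCoeff F n = 0 := if_pos h

theorem intCoeff_mul (F G : PowerSeries K) (n : ℤ) :
    intCoeff (F * G) n = ∑ᶠ i : ℤ, intCoeff F i * intCoeff G (n - i) := by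
  have hz : ∀ i : ℤ, intCoeff F i * intCoeff G (n - i) ≠ 0 → 0 ≤ i ∧ i ≤ n := by
    intro i hi
    by_contra hn
    apply hi
    by_cases h : i < 0
    · rw [intCoeff_of_neg F h, zero_mul]
    · rw [intCoeff_of_neg G (show n - i < 0 by omega), mul_zero]
  by_cases hn : n < 0
  · rw [intCoeff_of_neg _ hn, eq_comm]
    apply finsum_eq_zero_of_forall_eq_zero
    intro i
    by_contra hi
    have := hz i hi
    omega
  · obtain ⟨n, rfl⟩ : ∃ m : ℕ, n = m := ⟨n.toNat, by omega⟩
    rw [intCoeff_natCast, coeff_mul, Finset.Nat.sum_antidiagonal_eq_sum_range_succ_mk,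
      finsum_eq_sum_of_support_subset (s := (Finset.range (n + 1)).map Nat.castEmbedding),
      Finset.sum_map]
    · apply Finset.sum_congr rfl
      intro i hi
      have : ((n : ℤ) - i) = (n - i : ℕ) := by
        have := Finset.mem_range.mp hi
        omega
      simp only [Nat.castEmbedding_apply, this, intCoeff_natCast]
    · intro i hi
      have := hz i hi
      simp only [Finset.coe_map, Set.mem_image, Finset.mem_coe, Finset.mem_range,
        Nat.castEmbedding_apply]
      exact ⟨i.toNat, by omega, by omega⟩

theorem intCoeff_rescale (a : K) (F : PowerSeries K) (n : ℤ) :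
    intCoeff (rescale a F) n = a ^ n * intCoeff F n := by
  by_cases hn : n < 0
  · simp [intCoeff_of_neg _ hn]
  · obtain ⟨n, rfl⟩ : ∃ m : ℕ, n = m := ⟨n.toNat, by omega⟩
    simp [intCoeff_natCast, coeff_rescale]

theorem intCoeff_one_add_mul (a : K) (F : PowerSeries K) (n : ℤ) :
    intCoeff ((1 + C a * X) * F) n = intCoeff F n + a * intCoeff F (n - 1) := by
  by_cases hn : n < 0
  · simp [intCoeff_of_neg _ hn, intCoeff_of_neg _ (show n - 1 < 0 by omega)]
  · obtain ⟨n, rfl⟩ : ∃ m : ℕ, n = m := ⟨n.toNat, by omega⟩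
    rcases n with _ | n
    · rw [intCoeff_natCast, intCoeff_natCast, intCoeff_of_neg _ (by simp)]
      simp
    · rw [show ((n + 1 : ℕ) : ℤ) - 1 = n by push_cast; ring,
        intCoeff_natCast, intCoeff_natCast, intCoeff_natCast]
      simp [add_mul, mul_assoc, coeff_succ_X_mul]

/-- Euler's power series `∑ p ^ (n choose 2) s ^ n / (p; p)_n = (-s; p)_∞`. -/
noncomputable def eulerSeries (p : K) : PowerSeries K := PowerSeries.mk fun n => eulerCoeff p n

theorem intCoeff_eulerSeries (p : K) (n : ℤ) : intCoeff (eulerSeries p) n = eulerCoeff p n := by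
  by_cases hn : n < 0
  · rw [intCoeff_of_neg _ hn, eulerCoeff, qPochhammerRecip_of_neg p hn, mul_zero]
  · obtain ⟨n, rfl⟩ : ∃ m : ℕ, n = m := ⟨n.toNat, by omega⟩
    rw [intCoeff_natCast, eulerSeries, coeff_mk]

theorem eulerCoeff_recurrence (hp0 : p ≠ 0) (hp : ∀ n : ℕ, 0 < n → p ^ n ≠ 1) (n : ℤ) :
    eulerCoeff p n = p ^ n * eulerCoeff p n + p ^ (n - 1) * eulerCoeff p (n - 1) := by
  unfold eulerCoeff
  have h1 := qPochhammerRecip_sub_one hp n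
  have h2 : p ^ (n * (n - 1) / 2) = p ^ (n - 1) * p ^ ((n - 1) * (n - 1 - 1) / 2) := by
    rw [← zpow_add₀ hp0]
    congr 1
    have e1 := two_mul_int_choose_two n
    have e2 := two_mul_int_choose_two (n - 1)
    refine mul_left_cancel₀ (two_ne_zero : (2 : ℤ) ≠ 0) ?_
    linear_combination e1 - e2
  rw [h1, h2]
  ring

theorem powerSeries_ext_intCoeff {F G : PowerSeries K} (h : ∀ n, intCoeff F n = intCoeff G n) :
    F = G := by
  ext n
  rw [← intCoeff_natCast, ← intCoeff_natCast, h]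

/-- This is (-s;p)_∞ = (1+s)(-ps;p)_∞, which stands in for the infinite product throughout. -/
theorem eulerSeries_functional (hp0 : p ≠ 0) (hp : ∀ n : ℕ, 0 < n → p ^ n ≠ 1) :
    eulerSeries p = (1 + C 1 * X) * rescale p (eulerSeries p) := by
  apply powerSeries_ext_intCoeff
  intro n
  rw [intCoeff_one_add_mul, intCoeff_rescale, intCoeff_rescale, intCoeff_eulerSeries,
    intCoeff_eulerSeries, one_mul]
  exact eulerCoeff_recurrence hp0 hp n

theorem rescale_eulerSeries (hp0 : p ≠ 0) (hp : ∀ n : ℕ, 0 < n → p ^ n ≠ 1) (a : K) :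
    rescale a (eulerSeries p) = (1 + C a * X) * rescale (a * p) (eulerSeries p) := by
  conv_lhs => rw [eulerSeries_functional hp0 hp]
  rw [map_mul, rescale_rescale, map_add, map_mul, rescale_X, mul_comm p a]
  simp

/-- If all lower coefficients vanish, comparing coefficients of s^n leaves (1 - p^n) d_n = 0. -/
theorem eq_zero_of_eq_mul_rescale (hp : ∀ n : ℕ, 0 < n → p ^ n ≠ 1) {A D : PowerSeries K}
    (hA : constantCoeff A = 1) (h0 : constantCoeff D = 0) (hD : D = A * rescale p D) : D = 0 := by
  ext n
  induction n using Nat.strong_induction_on with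
  | _ n ih =>
    rcases Nat.eq_zero_or_pos n with rfl | hn
    · simpa using h0
    have h := congrArg (coeff n) hD
    rw [coeff_mul, Finset.sum_eq_single (0, n)] at h
    · rw [coeff_zero_eq_constantCoeff_apply, hA, one_mul, coeff_rescale] at h
      have h' : (1 - p ^ n) * coeff n D = 0 := by linear_combination h
      rcases mul_eq_zero.mp h' with h' | h'
      · exact absurd (sub_eq_zero.mp h').symm (hp n hn)
      · simpa using h'
    · rintro ⟨i, j⟩ hij hne
      rw [Finset.HasAntidiagonal.mem_antidiagonal] at hij
      have hj : j < n := by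
        rcases Nat.eq_zero_or_pos i with rfl | hi
        · exact absurd (by rw [show j = n by simpa using hij]) hne
        · simp only at hij; omega
      simp [coeff_rescale, ih j hj]
    · intro h; simp at h

theorem eq_of_eq_mul_rescale (hp : ∀ n : ℕ, 0 < n → p ^ n ≠ 1) {A F G : PowerSeries K}
    (hA : constantCoeff A = 1) (h0 : constantCoeff F = constantCoeff G)
    (hF : F = A * rescale p F) (hG : G = A * rescale p G) : F = G := by
  rw [← sub_eq_zero]
  refine eq_zero_of_eq_mul_rescale hp hA (by rw [map_sub, h0, sub_self]) ?_
  rw [map_sub, mul_sub, ← hF, ← hG]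

theorem constantCoeff_eulerSeries (p : K) : constantCoeff (eulerSeries p) = 1 := by
  rw [← coeff_zero_eq_constantCoeff_apply, eulerSeries, coeff_mk]
  simp [eulerCoeff, qPochhammerRecip_zero]

theorem constantCoeff_rescale_eulerSeries (a p : K) :
    constantCoeff (rescale a (eulerSeries p)) = 1 := by
  rw [← coeff_zero_eq_constantCoeff_apply, coeff_rescale, coeff_zero_eq_constantCoeff_apply,
    constantCoeff_eulerSeries]
  simp

theorem cube_pow_ne_one (hq : ∀ n : ℕ, 0 < n → q ^ n ≠ 1) (n : ℕ) (hn : 0 < n) :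
    (q ^ 3) ^ n ≠ 1 := by
  rw [← pow_mul]
  exact hq _ (by positivity)

/-- Splitting `(-s; q)_∞` according to exponents modulo three. -/
theorem eulerSeries_cube (hq0 : q ≠ 0) (hq : ∀ n : ℕ, 0 < n → q ^ n ≠ 1) :
    eulerSeries (q ^ 3) *
      (rescale q (eulerSeries (q ^ 3)) * rescale (q ^ 2) (eulerSeries (q ^ 3))) =
      eulerSeries q := by
  have hp := cube_pow_ne_one hq
  have hp0 : q ^ 3 ≠ 0 := pow_ne_zero 3 hq0
  -- Both sides have constant term 1 and satisfy F(s) = (1+s)(1+qs)(1+q²s) F(q³s), which determines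
  -- F.
  refine eq_of_eq_mul_rescale hp
    (A := (1 + C 1 * X) * ((1 + C q * X) * (1 + C (q ^ 2) * X))) (by simp) ?_ ?_ ?_
  · simp only [map_mul, constantCoeff_eulerSeries, constantCoeff_rescale_eulerSeries, mul_one]
  · have h1 := rescale_eulerSeries hp0 hp q
    have h2 := rescale_eulerSeries hp0 hp (q ^ 2)
    have h0 := eulerSeries_functional hp0 hp
    have h3 : rescale (q ^ 3) (eulerSeries (q ^ 3) *
        (rescale q (eulerSeries (q ^ 3)) * rescale (q ^ 2) (eulerSeries (q ^ 3)))) =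
        rescale (q ^ 3) (eulerSeries (q ^ 3)) * (rescale (q * q ^ 3) (eulerSeries (q ^ 3)) *
          rescale (q ^ 2 * q ^ 3) (eulerSeries (q ^ 3))) := by
      simp only [map_mul, rescale_rescale]
    rw [h3, mul_mul_mul_comm, ← h0, mul_mul_mul_comm, ← h1, ← h2]
  · have h1 := rescale_eulerSeries hq0 hq q
    have h2 := rescale_eulerSeries hq0 hq (q ^ 2)
    rw [show q ^ 2 * q = q ^ 3 by ring] at h2
    rw [← pow_two, h2] at h1
    conv_lhs => rw [eulerSeries_functional hq0 hq, h1]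
    ring

theorem tripleCoeff_eq_intCoeff (p : K) {z : K} (hz : z ≠ 0) (m : ℤ) :
    tripleCoeff p z m = intCoeff (rescale z⁻¹ (eulerSeries p) *
      (rescale z (eulerSeries p) * eulerSeries p)) m := by
  rw [intCoeff_mul, tripleCoeff]
  apply finsum_congr; intro x
  rw [intCoeff_mul, mul_finsum]
  apply finsum_congr; intro y
  rw [intCoeff_rescale, intCoeff_rescale]
  simp only [intCoeff_eulerSeries]
  rw [zpow_sub₀ hz, inv_zpow]
  ring

/-- The arguments s/q, s, sq are those of the mod 3 splitting with s replaced by s/q, so the product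
is (-s/q;q)_∞. -/
theorem tripleCoeff_cube_self (hq0 : q ≠ 0) (hq : ∀ n : ℕ, 0 < n → q ^ n ≠ 1) (m : ℤ) :
    tripleCoeff (q ^ 3) q m = q ^ (-m) * eulerCoeff q m := by
  rw [tripleCoeff_eq_intCoeff _ hq0, ← intCoeff_eulerSeries, zpow_neg, ← inv_zpow,
    ← intCoeff_rescale, ← eulerSeries_cube hq0 hq]
  simp only [map_mul, rescale_rescale]
  rw [mul_inv_cancel₀ hq0, show q ^ 2 * q⁻¹ = q by field_simp, rescale_one]
  simp only [RingHom.id_apply]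
  congr 1
  ring

/-- Peeling the first factor off (-s/q²;q³)_∞ leaves (-sq;q³)_∞, so the product is (1 +
s/q²)(-s;q)_∞. -/
theorem tripleCoeff_cube_sq (hq0 : q ≠ 0) (hq : ∀ n : ℕ, 0 < n → q ^ n ≠ 1) (m : ℤ) :
    tripleCoeff (q ^ 3) (q ^ 2) m = eulerCoeff q m + q ^ (-2 : ℤ) * eulerCoeff q (m - 1) := by
  rw [tripleCoeff_eq_intCoeff _ (pow_ne_zero 2 hq0), ← intCoeff_eulerSeries,
    ← intCoeff_eulerSeries, ← intCoeff_one_add_mul, ← eulerSeries_cube hq0 hq,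
    rescale_eulerSeries (pow_ne_zero 3 hq0) (cube_pow_ne_one hq),
    show (q ^ 2)⁻¹ * q ^ 3 = q by field_simp, show (q ^ 2)⁻¹ = q ^ (-2 : ℤ) by
      rw [zpow_neg]; norm_cast]
  congr 1
  ring

end TripleProduct

/-! ### Contiguous relations and assembly of the double sums -/

section DoubleSum

variable {K : Type*} [Field K] {q : K}

/-- The summand of `capparelliSum`. -/
noncomputable def capparelliTerm (q : K) (N a b : ℤ) (t : ℤ × ℤ) : K :=
  q ^ (2 * t.1 ^ 2 + 6 * t.1 * t.2 + 6 * t.2 ^ 2 + a * t.1 + b * t.2) *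
    (qPochhammerRecip q t.1 * qPochhammerRecip (q ^ 3) t.2 *
      qPochhammerRecip (q ^ 3) (N - 2 * t.2 - t.1))

/-- The double sum `∑ q ^ (Q(m, n) + a m + b n) / ((q; q)_m (q³; q³)_n (q³; q³)_(N-2n-m))`. -/
noncomputable def capparelliSum (q : K) (N a b : ℤ) : K := ∑ᶠ t, capparelliTerm q N a b t

theorem capparelliTerm_support {N a b : ℤ} {t : ℤ × ℤ} (h : capparelliTerm q N a b t ≠ 0) :
    0 ≤ t.1 ∧ 0 ≤ t.2 ∧ 0 ≤ N - 2 * t.2 - t.1 := by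
  simp only [capparelliTerm, ne_eq, mul_eq_zero, not_or] at h
  obtain ⟨-, ⟨h1, h2⟩, h3⟩ := h
  exact ⟨nonneg_of_qPochhammerRecip_ne_zero h1, nonneg_of_qPochhammerRecip_ne_zero h2,
    nonneg_of_qPochhammerRecip_ne_zero h3⟩

theorem capparelliTerm_support_finite (q : K) (N a b : ℤ) :
    Function.HasFiniteSupport (capparelliTerm q N a b) := by
  refine (Set.finite_Icc ((0, 0) : ℤ × ℤ) (N, N)).subset ?_
  rintro ⟨m, n⟩ h
  have := capparelliTerm_support h
  simp only [Set.mem_Icc, Prod.mk_le_mk]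
  simp only at this
  omega

theorem smul_capparelliTerm_support_finite (c q : K) (N a b : ℤ) :
    Function.HasFiniteSupport fun t => c * capparelliTerm q N a b t :=
  (capparelliTerm_support_finite q N a b).subset fun _ ht => right_ne_zero_of_mul ht

theorem finsum_int_prod_shift (f : ℤ × ℤ → K) (a : ℤ × ℤ) : ∑ᶠ t, f (t + a) = ∑ᶠ t, f t :=
  finsum_comp_equiv (Equiv.addRight a)

/-- The factor 1 - q^(3(N-2n-m)) lowers the last index. The next two relations use 1 - q^m and 1 -
q^(3n) in the same way, followed by a shift of m or n. -/
theorem capparelliSum_pred (hq0 : q ≠ 0) (hq : ∀ n : ℕ, 0 < n → q ^ n ≠ 1) (N a b : ℤ) :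
    capparelliSum q N (a + 3) (b + 6) - (q ^ 3) ^ N * capparelliSum q N a b =
      capparelliSum q (N - 1) (a + 3) (b + 6) := by
  unfold capparelliSum
  rw [mul_finsum, ← finsum_sub_distrib (capparelliTerm_support_finite _ _ _ _)
    (smul_capparelliTerm_support_finite _ _ _ _ _)]
  apply finsum_congr
  rintro ⟨m, n⟩
  simp only [capparelliTerm]
  have h := qPochhammerRecip_sub_one (cube_pow_ne_one hq) (N - 2 * n - m)
  rw [show N - 1 - 2 * n - m = N - 2 * n - m - 1 by ring, h]
  have e : (q ^ 3) ^ N * q ^ (2 * m ^ 2 + 6 * m * n + 6 * n ^ 2 + a * m + b * n) =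
      q ^ (2 * m ^ 2 + 6 * m * n + 6 * n ^ 2 + (a + 3) * m + (b + 6) * n) *
        (q ^ 3) ^ (N - 2 * n - m) := by
    simp only [← zpow_natCast, ← zpow_mul, ← zpow_add₀ hq0]
    congr 1; push_cast; ring
  rw [← mul_assoc ((q ^ 3) ^ N), e]
  ring

theorem capparelliSum_sub_left (hq0 : q ≠ 0) (hq : ∀ n : ℕ, 0 < n → q ^ n ≠ 1) (N a b : ℤ) :
    capparelliSum q N a b - capparelliSum q N (a + 1) b =
      q ^ (a + 2) * capparelliSum q (N - 1) (a + 4) (b + 6) := by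
  unfold capparelliSum
  rw [mul_finsum, ← finsum_sub_distrib (capparelliTerm_support_finite _ _ _ _)
    (capparelliTerm_support_finite _ _ _ _), ← finsum_int_prod_shift (fun t => q ^ (a + 2) * _) (-1, 0)]
  apply finsum_congr
  rintro ⟨m, n⟩
  simp only [capparelliTerm, Prod.mk_add_mk, add_zero]
  have h := qPochhammerRecip_sub_one hq m
  rw [show N - 1 - 2 * n - (m + -1) = N - 2 * n - m by ring, show m + -1 = m - 1 by ring, h]
  have e1 : q ^ (a + 2) * q ^ (2 * (m - 1) ^ 2 + 6 * (m - 1) * n + 6 * n ^ 2 +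
      (a + 4) * (m - 1) + (b + 6) * n) =
      q ^ (2 * m ^ 2 + 6 * m * n + 6 * n ^ 2 + a * m + b * n) := by
    rw [← zpow_add₀ hq0]; congr 1; ring
  have e2 : q ^ (2 * m ^ 2 + 6 * m * n + 6 * n ^ 2 + (a + 1) * m + b * n) =
      q ^ (2 * m ^ 2 + 6 * m * n + 6 * n ^ 2 + a * m + b * n) * q ^ m := by
    rw [← zpow_add₀ hq0]; congr 1; ring
  rw [← mul_assoc (q ^ (a + 2)), e1, e2]
  ring

theorem capparelliSum_sub_right (hq0 : q ≠ 0) (hq : ∀ n : ℕ, 0 < n → q ^ n ≠ 1) (N a b : ℤ) :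
    capparelliSum q N a b - capparelliSum q N a (b + 3) =
      q ^ (b + 6) * capparelliSum q (N - 2) (a + 6) (b + 12) := by
  unfold capparelliSum
  rw [mul_finsum, ← finsum_sub_distrib (capparelliTerm_support_finite _ _ _ _)
    (capparelliTerm_support_finite _ _ _ _), ← finsum_int_prod_shift (fun t => q ^ (b + 6) * _) (0, -1)]
  apply finsum_congr
  rintro ⟨m, n⟩
  simp only [capparelliTerm, Prod.mk_add_mk, add_zero]
  have h := qPochhammerRecip_sub_one (cube_pow_ne_one hq) n
  rw [show N - 2 - 2 * (n + -1) - m = N - 2 * n - m by ring, show n + -1 = n - 1 by ring, h]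
  have e1 : q ^ (b + 6) * q ^ (2 * m ^ 2 + 6 * m * (n - 1) + 6 * (n - 1) ^ 2 +
      (a + 6) * m + (b + 12) * (n - 1)) =
      q ^ (2 * m ^ 2 + 6 * m * n + 6 * n ^ 2 + a * m + b * n) := by
    rw [← zpow_add₀ hq0]; congr 1; ring
  have e2 : q ^ (2 * m ^ 2 + 6 * m * n + 6 * n ^ 2 + a * m + (b + 3) * n) =
      q ^ (2 * m ^ 2 + 6 * m * n + 6 * n ^ 2 + a * m + b * n) * (q ^ 3) ^ n := by
    rw [← zpow_natCast, ← zpow_mul, ← zpow_add₀ hq0]; congr 1; push_cast; ring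
  rw [← mul_assoc (q ^ (b + 6)), e1, e2]
  ring

theorem capparelliSum_relation (hq0 : q ≠ 0) (hq : ∀ n : ℕ, 0 < n → q ^ n ≠ 1) (N : ℤ) :
    capparelliSum q N 1 3 + q * capparelliSum q N 3 6 =
      capparelliSum q N 1 0 + q * capparelliSum q (N - 1) 4 6 +
        q * (q ^ 3) ^ N * capparelliSum q N 0 0 := by
  have h1 := capparelliSum_pred hq0 hq N 0 0
  have h2 := capparelliSum_sub_left hq0 hq (N - 1) 3 6
  have h3 := capparelliSum_sub_right hq0 hq N 1 0
  norm_num at h1 h2 h3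
  rw [show N - 1 - 1 = N - 2 by ring] at h2
  -- The terms in S_(N-1)(3,6) cancel, and so do the two copies of q^6 S_(N-2)(7,12).
  linear_combination q * h1 + q * h2 - h3

theorem finsum_theta_qBinomial_cube_self (hq0 : q ≠ 0) (hq : ∀ n : ℕ, 0 < n → q ^ n ≠ 1)
    (M : ℕ) :
    ∑ᶠ a : ℤ, (q ^ 3) ^ (a ^ 2) * q ^ a * qBinomial (q ^ 3) (2 * M : ℕ) (M - a) =
      qPochhammer (q ^ 3) (q ^ 3) M * capparelliSum q M 0 0 := by
  rw [finsum_theta_qBinomial (pow_ne_zero 3 hq0) (cube_pow_ne_one hq), capparelliSum]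
  congr 1
  apply finsum_congr
  rintro ⟨m, k⟩
  simp only [tripleCoeff_cube_self hq0 hq, capparelliTerm, eulerCoeff]
  have e : (q ^ 3) ^ (2 * k ^ 2 + 2 * k * m + (m + 1) * m / 2) * q ^ (-m) *
      q ^ (m * (m - 1) / 2) = q ^ (2 * m ^ 2 + 6 * m * k + 6 * k ^ 2 + 0 * m + 0 * k) := by
    rw [← zpow_natCast, ← zpow_mul, ← zpow_add₀ hq0, ← zpow_add₀ hq0]
    congr 1
    have h1 := two_mul_int_choose_two (m + 1)
    rw [add_sub_cancel_right] at h1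
    have h2 := two_mul_int_choose_two m
    refine mul_left_cancel₀ (two_ne_zero : (2 : ℤ) ≠ 0) ?_
    push_cast
    linear_combination 3 * h1 + h2
  rw [← e]
  ring

theorem finsum_theta_qBinomial_cube_sq (hq0 : q ≠ 0) (hq : ∀ n : ℕ, 0 < n → q ^ n ≠ 1)
    (M : ℕ) :
    ∑ᶠ a : ℤ, (q ^ 3) ^ (a ^ 2) * (q ^ 2) ^ a * qBinomial (q ^ 3) (2 * M : ℕ) (M - a) =
      qPochhammer (q ^ 3) (q ^ 3) M *
        (capparelliSum q M 1 0 + q * capparelliSum q (M - 1) 4 6) := by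
  rw [finsum_theta_qBinomial (pow_ne_zero 3 hq0) (cube_pow_ne_one hq), capparelliSum,
    capparelliSum, mul_finsum _ q, ← finsum_int_prod_shift (fun t => q * _) (-1, 0),
    ← finsum_add_distrib (capparelliTerm_support_finite _ _ _ _)]
  · congr 1
    apply finsum_congr
    rintro ⟨m, k⟩
    simp only [tripleCoeff_cube_sq hq0 hq, capparelliTerm, eulerCoeff, Prod.mk_add_mk, add_zero]
    rw [show (M : ℤ) - 1 - 2 * k - (m + -1) = M - 2 * k - m by ring, show m + -1 = m - 1 by ring]
    have h1 := two_mul_int_choose_two (m + 1)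
    rw [add_sub_cancel_right] at h1
    have h2 := two_mul_int_choose_two m
    have h3 := two_mul_int_choose_two (m - 1)
    have e1 : (q ^ 3) ^ (2 * k ^ 2 + 2 * k * m + (m + 1) * m / 2) *
        q ^ (m * (m - 1) / 2) = q ^ (2 * m ^ 2 + 6 * m * k + 6 * k ^ 2 + 1 * m + 0 * k) := by
      rw [← zpow_natCast, ← zpow_mul, ← zpow_add₀ hq0]
      congr 1
      refine mul_left_cancel₀ (two_ne_zero : (2 : ℤ) ≠ 0) ?_
      push_cast
      linear_combination 3 * h1 + h2
    have e2 : (q ^ 3) ^ (2 * k ^ 2 + 2 * k * m + (m + 1) * m / 2) * q ^ (-2 : ℤ) *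
        q ^ ((m - 1) * (m - 1 - 1) / 2) =
        q * q ^ (2 * (m - 1) ^ 2 + 6 * (m - 1) * k + 6 * k ^ 2 + 4 * (m - 1) + 6 * k) := by
      rw [← zpow_natCast, ← zpow_mul, ← zpow_add₀ hq0, ← zpow_add₀ hq0, ← zpow_one_add₀ hq0]
      congr 1
      refine mul_left_cancel₀ (two_ne_zero : (2 : ℤ) ≠ 0) ?_
      push_cast
      linear_combination 3 * h1 + h3
    rw [← mul_assoc q, ← e1, ← e2]
    ring
  · exact (smul_capparelliTerm_support_finite q q (M - 1) 4 6).preimage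
      (add_left_injective ((-1, 0) : ℤ × ℤ)).injOn

theorem finsum_theta_qBinomial_odd (hq0 : q ≠ 0) (hq : ∀ n : ℕ, 0 < n → q ^ n ≠ 1) (M : ℕ) :
    ∑ᶠ j : ℤ, q ^ (3 * j ^ 2 + 2 * j) * qBinomial (q ^ 3) (2 * M + 1 : ℕ) (M - j) =
      qPochhammer (q ^ 3) (q ^ 3) M *
        (capparelliSum q M 1 3 + q * capparelliSum q M 3 6) := by
  have hp0 : q ^ 3 ≠ 0 := pow_ne_zero 3 hq0
  have hp := cube_pow_ne_one hq
  have fin : ∀ g : ℤ → K, (Function.support fun b : ℤ =>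
      g b * qBinomial (q ^ 3) (2 * M : ℕ) (M - b)).Finite := by
    intro g
    apply finite_support_int (-M) M
    intro k hk
    have := bounds_of_qBinomial_ne_zero (right_ne_zero_of_mul hk)
    push_cast at this
    omega
  have hneg : ∑ᶠ b : ℤ, q * (q ^ 3) ^ M * ((q ^ 3) ^ (b ^ 2) * q ^ b *
      qBinomial (q ^ 3) (2 * M : ℕ) (M - b)) = ∑ᶠ b : ℤ, q * (q ^ 3) ^ M * ((q ^ 3) ^ (b ^ 2) *
      q ^ (-b)) * qBinomial (q ^ 3) (2 * M : ℕ) (M - b) := by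
    -- Reflection b ↦ -b fixes [2M, M-b]; it turns z = q into the q^(-b) that Pascal produces.
    rw [← finsum_comp_equiv (Equiv.neg ℤ)]
    apply finsum_congr
    intro b
    rw [Equiv.neg_apply, neg_sq, ← qBinomial_symm,
      show ((2 * M : ℕ) : ℤ) - (M - -b) = M - b by push_cast; ring]
    ring
  rw [capparelliSum_relation hq0 hq, mul_add, ← finsum_theta_qBinomial_cube_sq hq0 hq,
    mul_left_comm, ← finsum_theta_qBinomial_cube_self hq0 hq, zpow_natCast, mul_finsum, hneg]
  -- The second Pascal term contains [2M, M-j-1], hence b = j + 1; completing the square gives the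
  -- prefactor q^(1+3M).
  refine finsum_eq_add_of_shift 1 ?_ (fin _) (fin _)
  intro j
  rw [qBinomial_succ hp0 hp, show (M : ℤ) - (j + 1) = M - j - 1 by ring]
  have e1 : q ^ (3 * j ^ 2 + 2 * j) = (q ^ 3) ^ (j ^ 2) * (q ^ 2) ^ j := by
    simp only [← zpow_natCast, ← zpow_mul, ← zpow_add₀ hq0]
    congr 1
  have e2 : q ^ (3 * j ^ 2 + 2 * j) * (q ^ 3) ^ (((2 * M : ℕ) : ℤ) + 1 - (M - j)) =
      q * (q ^ 3) ^ M * ((q ^ 3) ^ ((j + 1) ^ 2) * q ^ (-(j + 1))) := by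
    simp only [← zpow_natCast, ← zpow_mul, ← zpow_add₀ hq0, ← zpow_one_add₀ hq0]
    congr 1
    push_cast
    ring
  rw [mul_add, ← mul_assoc, e2, e1]

theorem finsum_int_prod_eq_finsum_nat_prod (f : ℤ × ℤ → K)
    (hf : ∀ t, f t ≠ 0 → 0 ≤ t.1 ∧ 0 ≤ t.2) :
    ∑ᶠ t, f t = ∑ᶠ t : ℕ × ℕ, f (t.1, t.2) := by
  have hinj : Function.Injective fun t : ℕ × ℕ => ((t.1, t.2) : ℤ × ℤ) := by
    rintro ⟨a, b⟩ ⟨c, d⟩ h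
    simpa using h
  rw [← finsum_mem_range (f := f) hinj, finsum_mem_def, Set.indicator_eq_self.mpr]
  rintro ⟨m, n⟩ h
  have := hf _ h
  exact ⟨(m.toNat, n.toNat), by ext <;> simp <;> omega⟩

theorem finsum_capparelliFactor (q : K) (M a b : ℕ) :
    ∑ᶠ t : ℕ × ℕ, q ^ (capparelliQ t.1 t.2 + a * t.1 + b * t.2) * capparelliFactor q M t.1 t.2 =
      qPochhammer (q ^ 3) (q ^ 3) M * capparelliSum q M a b := by
  rw [capparelliSum, finsum_int_prod_eq_finsum_nat_prod _ fun t h =>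
    ⟨(capparelliTerm_support h).1, (capparelliTerm_support h).2.1⟩, mul_finsum]
  apply finsum_congr
  rintro ⟨m, n⟩
  simp only [capparelliTerm, capparelliFactor, capparelliQ]
  rw [← zpow_natCast]
  push_cast
  ring

theorem qBinomial_mem_subring (R : Subring K) (hq0 : q ≠ 0) (hq : ∀ n : ℕ, 0 < n → q ^ n ≠ 1)
    (hR : q ∈ R) (N : ℕ) (k : ℤ) : qBinomial q N k ∈ R := by
  induction N generalizing k with
  | zero =>
    rw [qBinomial_zero_left]
    split_ifs
    exacts [R.one_mem, R.zero_mem]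
  | succ N ih =>
    rw [qBinomial_succ hq0 hq]
    refine R.add_mem (ih k) ?_
    by_cases h : 0 ≤ (N : ℤ) + 1 - k
    · obtain ⟨n, hn⟩ := Int.eq_ofNat_of_zero_le h
      rw [hn, zpow_natCast]
      exact R.mul_mem (R.pow_mem hR n) (ih _)
    -- A negative power of q occurs only where its q-binomial vanishes.
    · rw [show qBinomial q N (k - 1) = 0 from if_neg (by omega), mul_zero]
      exact R.zero_mem

end DoubleSum

theorem ratFunc_X_pow_ne_one (n : ℕ) (hn : 0 < n) : (RatFunc.X : RatFunc ℚ) ^ n ≠ 1 := by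
  intro h
  rw [← RatFunc.algebraMap_X, ← map_pow, ← map_one (algebraMap (Polynomial ℚ) (RatFunc ℚ))] at h
  have h' := congrArg Polynomial.natDegree (RatFunc.algebraMap_injective ℚ h)
  rw [Polynomial.natDegree_X_pow, Polynomial.natDegree_one] at h'
  omega

theorem mainTheorem4 (M : ℕ) (q : RatFunc ℚ) (hq : q = RatFunc.X) :
    ((∑ᶠ p : ℕ × ℕ,
          q ^ (capparelliQ p.1 p.2 + p.1 + 3 * p.2) * capparelliFactor q M p.1 p.2) +
        (∑ᶠ p : ℕ × ℕ,
          q ^ (capparelliQ p.1 p.2 + 3 * p.1 + 6 * p.2 + 1) * capparelliFactor q M p.1 p.2) =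
      ∑ j ∈ Finset.Icc (-(M : ℤ) - 1) (M : ℤ),
        q ^ (3 * j ^ 2 + 2 * j) * qBinomial (q ^ 3) (2 * (M : ℤ) + 1) ((M : ℤ) - j)) ∧
    (∃ P : Polynomial ℤ,
      ∑ j ∈ Finset.Icc (-(M : ℤ) - 1) (M : ℤ),
        q ^ (3 * j ^ 2 + 2 * j) * qBinomial (q ^ 3) (2 * (M : ℤ) + 1) ((M : ℤ) - j) =
      Polynomial.aeval q P) := by
  have hq0 : q ≠ 0 := hq ▸ RatFunc.X_ne_zero
  have hq1 : ∀ n : ℕ, 0 < n → q ^ n ≠ 1 := hq ▸ ratFunc_X_pow_ne_one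
  have hcast : 2 * (M : ℤ) + 1 = (2 * M + 1 : ℕ) := by push_cast; ring
  rw [hcast]
  constructor
  · have h1 := finsum_capparelliFactor q M 1 3
    have h2 := finsum_capparelliFactor q M 3 6
    simp only [one_mul] at h1
    simp only [pow_succ' q (_ + 6 * _), mul_assoc q]
    rw [h1, ← mul_finsum, h2, mul_left_comm, ← mul_add]
    push_cast
    rw [← finsum_theta_qBinomial_odd hq0 hq1, finsum_eq_sum_of_support_subset]
    · push_cast; rfl
    · intro j hj
      have := bounds_of_qBinomial_ne_zero (right_ne_zero_of_mul hj)
      push_cast at this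
      rw [Finset.mem_coe, Finset.mem_Icc]
      omega
  -- The range is the subring ℤ[q] of ℚ(q); membership is checked term by term.
  · have hmem : q ∈ (Polynomial.aeval (R := ℤ) q).toRingHom.range :=
      ⟨Polynomial.X, Polynomial.aeval_X q⟩
    obtain ⟨P, hP⟩ : ∑ j ∈ Finset.Icc (-(M : ℤ) - 1) (M : ℤ),
        q ^ (3 * j ^ 2 + 2 * j) * qBinomial (q ^ 3) (2 * M + 1 : ℕ) ((M : ℤ) - j) ∈
        (Polynomial.aeval (R := ℤ) q).toRingHom.range := by
      refine Subring.sum_mem _ fun j _ => Subring.mul_mem _ ?_ (qBinomial_mem_subring _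
        (pow_ne_zero 3 hq0) (cube_pow_ne_one hq1) (Subring.pow_mem _ hmem 3) _ _)
      have hj : 0 ≤ 3 * j ^ 2 + 2 * j := by
        rcases le_or_gt 0 j with h | h
        · positivity
        · nlinarith
      obtain ⟨n, hn⟩ := Int.eq_ofNat_of_zero_le hj
      rw [hn, zpow_natCast]
      exact Subring.pow_mem _ hmem n
    exact ⟨P, hP.symm⟩
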